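/- Let $\mathcal H$ be a complex Hilbert space with an orthonormal basis $(|n\rangle)_{n\in\mathbb N}$, $\mathbb N=\{0,1,2,\dots\}$, and let $\mathbb T=\{t\in\mathbb C:|t|=1\}$, with normalized Haar measure $dt$. For $t\in\mathbb T$ let $U(t)$ be the unitary operator on $\mathcal H$ with $U(t)|n\rangle=t^n|n\rangle$ for all $n$. An *observable* on $\mathbb T$ is a map $E$ from the Borel sets of $\mathbb T$ to the bounded operators on $\mathcal H$ such that $0\le E(X)\le I$ for all $X$, $E(\mathbb T)=I$, and $E(\bigcup_i X_i)=\sum_i E(X_i)$ in the weak operator topology for every sequence of disjoint Borel sets. A *phase observable* is an observable with $U(t)E(X)U(t)^*=E(tX)$ for all $t\in\mathbb T$ and all Borel sets $X$. A *phase matrix* is a positive semidefinite complex $\mathbb N\times\mathbb N$ matrix $(c_{m,n})$ with $c_{n,n}=1$ for all $n$. The phase observable corresponding to $(c_{m,n})$ is the unique phase observable $E$ with $$\langle m|E(X)|n\rangle=c_{m,n}\int_X t^{m-n}\,dt\qquad\text{for all } m,n\in\mathbb N \text{ and all Borel sets } X\subseteq\mathbb T .$$ The *rank* of a phase matrix is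 the dimension of a Hilbert space $\mathcal K$ that contains a sequence of unit vectors $(\eta_n)_{n\in\mathbb N}$ with dense linear span and $c_{n,m}=\langle\eta_n|\eta_m\rangle$ for all $n,m$; such a $\mathcal K$ exists and its dimension depends only on the matrix. An element of a convex set is *extremal* if it is not a nontrivial convex combination of other elements of the set. **Proposition.** Let $(c_{m,n})$ be a phase matrix of rank greater than $1$ such that $c_{m,n}\in\mathbb R$ for all $m,n\in\mathbb N$. Then $(c_{m,n})$ is not extremal in the convex set of all phase matrices. Moreover, the phase observable corresponding to $(c_{m,n})$ exists, is unique, and is not extremal in the convex set of all phase observables. -/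

import Mathlib

open MeasureTheory Matrix
open scoped InnerProductSpace Pointwise ComplexOrder

noncomputable section

/-! ### Phase matrices -/

/-- The set of phase matrices: positive semidefinite complex `ℕ × ℕ` matrices with unit diagonal. -/
def phaseMatrices : Set (Matrix ℕ ℕ ℂ) :=
  {c | c.PosSemidef ∧ ∀ n, c n n = 1}

/-- `η` is a total sequence of unit vectors in `K` whose Gram matrix is `c`. -/
structure IsVectorSequence {K : Type*} [NormedAddCommGroup K] [InnerProductSpace ℂ K]
    (c : Matrix ℕ ℕ ℂ) (η : ℕ → K) : Prop where
  norm_eq_one : ∀ n, ‖η n‖ = 1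
  total : (Submodule.span ℂ (Set.range η)).topologicalClosure = ⊤
  gram : ∀ n m, c n m = ⟪η n, η m⟫_ℂ

/-- The rank of a phase matrix `c`, in `ℕ∞`: the dimension of a Hilbert space carrying a total
sequence of unit vectors with Gram matrix `c`. Such a space exists
(`exists_isVectorSequence`) and all of them have the same dimension (`phaseRank_eq`), so that the
infimum below is over a singleton. (The spaces are separable, so every infinite dimension is `⊤`.) -/
def phaseRank (c : Matrix ℕ ℕ ℂ) : ℕ∞ :=
  sInf {r | ∃ (K : Type) (_ : NormedAddCommGroup K) (_ : InnerProductSpace ℂ K)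
    (_ : CompleteSpace K) (η : ℕ → K),
    IsVectorSequence c η ∧ r = Cardinal.toENat (Module.rank ℂ K)}

theorem exists_isVectorSequence {c : Matrix ℕ ℕ ℂ} (hc : c ∈ phaseMatrices) :
    ∃ (K : Type) (_ : NormedAddCommGroup K) (_ : InnerProductSpace ℂ K)
      (_ : CompleteSpace K) (η : ℕ → K), IsVectorSequence c η := by
  obtain ⟨κ, hk⟩ : ∃ κ : Matrix ℕ ℕ (ℂ →L[ℂ] ℂ),
      ∀ x y, κ x y = c x y • ContinuousLinearMap.id ℂ ℂ :=
    ⟨Matrix.of fun x y => c x y • ContinuousLinearMap.id ℂ ℂ, fun _ _ => rfl⟩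
  have hherm : κ.IsHermitian := by
    ext x y
    rw [Matrix.conjTranspose_apply, hk, hk, star_smul, hc.1.1.apply x y]
    simp [ContinuousLinearMap.star_eq_adjoint, ContinuousLinearMap.adjoint_id]
  have hκ : κ.PosSemidef := by
    have htfae := (RKHS.posSemidef_tfae (K := κ)).out 0 2
    rw [htfae]
    refine ⟨hherm, fun v => ?_⟩
    have h := (Complex.le_def.mp (hc.1.2 v)).1
    refine le_of_le_of_eq h ?_
    simp only [Finsupp.sum, Complex.re_sum, map_sum, RCLike.re_to_complex]
    refine Finset.sum_congr rfl fun x _ => Finset.sum_congr rfl fun y _ => ?_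
    rw [hk, ← hc.1.1.apply y x]
    simp
    ring
  have : Fact κ.PosSemidef := ⟨hκ⟩
  refine ⟨RKHS.OfKernel κ, inferInstance, inferInstance, inferInstance,
    fun n => RKHS.kerFun (RKHS.OfKernel κ) n 1, ?_⟩
  have hg : ∀ n m, c n m = ⟪RKHS.kerFun (RKHS.OfKernel κ) n (1 : ℂ),
      RKHS.kerFun (RKHS.OfKernel κ) m (1 : ℂ)⟫_ℂ := by
    intro n m
    rw [RKHS.kerFun_inner, RKHS.kerFun_apply, RKHS.OfKernel.kernel_ofKernel]
    simp [hk]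
  refine ⟨fun n => ?_, ?_, hg⟩
  · have h := hg n n
    rw [hc.2 n, inner_self_eq_norm_sq_to_K] at h
    have h' : ‖RKHS.kerFun (RKHS.OfKernel κ) n (1 : ℂ)‖ ^ 2 = 1 :=
      Complex.ofReal_injective (by rw [Complex.ofReal_pow, Complex.ofReal_one]; exact h.symm)
    exact (pow_eq_one_iff_of_nonneg (norm_nonneg _) two_ne_zero).mp h'
  · rw [eq_top_iff, ← RKHS.kerFun_dense (H := RKHS.OfKernel κ)]
    refine Submodule.topologicalClosure_mono (Submodule.span_le.mpr ?_)
    rintro _ ⟨n, v, rfl⟩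
    have : RKHS.kerFun (RKHS.OfKernel κ) n v = v • RKHS.kerFun (RKHS.OfKernel κ) n (1 : ℂ) := by
      rw [← map_smul, smul_eq_mul, mul_one]
    rw [this]
    exact Submodule.smul_mem _ _ (Submodule.subset_span ⟨n, rfl⟩)

theorem toENat_rank_eq {K₁ K₂ : Type} [NormedAddCommGroup K₁] [InnerProductSpace ℂ K₁]
    [NormedAddCommGroup K₂] [InnerProductSpace ℂ K₂] {c : Matrix ℕ ℕ ℂ} {η₁ : ℕ → K₁}
    {η₂ : ℕ → K₂} (h₁ : IsVectorSequence c η₁) (h₂ : IsVectorSequence c η₂) :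
    Cardinal.toENat (Module.rank ℂ K₁) = Cardinal.toENat (Module.rank ℂ K₂) := by
  have key : ∀ {K : Type} [NormedAddCommGroup K] [InnerProductSpace ℂ K] {η : ℕ → K},
      IsVectorSequence c η → Cardinal.toENat (Module.rank ℂ K) =
        Cardinal.toENat (Module.rank ℂ (Submodule.span ℂ (Set.range η))) := by
    intro K _ _ η h
    by_cases hfin : FiniteDimensional ℂ (Submodule.span ℂ (Set.range η))
    · have ht : Submodule.span ℂ (Set.range η) = ⊤ := by
        rw [← h.total]
        exact ((Submodule.span ℂ (Set.range η)).closed_of_finiteDimensional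
          ).submodule_topologicalClosure_eq.symm
      rw [ht, rank_top]
    · have hle := Submodule.rank_le (Submodule.span ℂ (Set.range η))
      have h0 : Cardinal.aleph0 ≤ Module.rank ℂ (Submodule.span ℂ (Set.range η)) := by
        rw [← not_lt, Module.rank_lt_aleph0_iff]; exact hfin
      rw [Cardinal.toENat_eq_top.mpr h0, Cardinal.toENat_eq_top.mpr (h0.trans hle)]
  have hker : LinearMap.ker (Finsupp.linearCombination ℂ η₁) =
      LinearMap.ker (Finsupp.linearCombination ℂ η₂) := by
    ext f
    have hin : ⟪Finsupp.linearCombination ℂ η₁ f, Finsupp.linearCombination ℂ η₁ f⟫_ℂ =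
        ⟪Finsupp.linearCombination ℂ η₂ f, Finsupp.linearCombination ℂ η₂ f⟫_ℂ := by
      simp only [Finsupp.linearCombination_apply, Finsupp.sum, sum_inner, inner_sum,
        inner_smul_left, inner_smul_right, ← h₁.gram, ← h₂.gram]
    rw [LinearMap.mem_ker, LinearMap.mem_ker, ← inner_self_eq_zero (𝕜 := ℂ), hin,
      inner_self_eq_zero]
  rw [key h₁, key h₂, ← Finsupp.range_linearCombination, ← Finsupp.range_linearCombination,
    ← (Finsupp.linearCombination ℂ η₁).quotKerEquivRange.rank_eq,
    ← (Finsupp.linearCombination ℂ η₂).quotKerEquivRange.rank_eq, hker]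

theorem phaseRank_eq {K : Type} [NormedAddCommGroup K] [InnerProductSpace ℂ K]
    [CompleteSpace K] {c : Matrix ℕ ℕ ℂ} {η : ℕ → K} (h : IsVectorSequence c η) :
    phaseRank c = Cardinal.toENat (Module.rank ℂ K) := by
  refine le_antisymm (sInf_le ⟨K, _, _, inferInstance, η, h, rfl⟩) (le_sInf ?_)
  rintro r ⟨K', _, _, _, η', h', rfl⟩
  exact (toENat_rank_eq h h').le

/-! ### Observables -/

/-- A set function on the measurable sets with values in the bounded operators. These form a real
vector space under pointwise operations. -/
abbrev OperatorSetFunction (Ω H : Type*) [MeasurableSpace Ω] [NormedAddCommGroup H]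
    [InnerProductSpace ℂ H] : Type _ :=
  {X : Set Ω // MeasurableSet X} → (H →L[ℂ] H)

/-- Observables: normalized positive operator valued measures. The order on operators is
the Loewner order; the sum in the last axiom converges in the weak operator topology. -/
structure IsObservable {Ω H : Type*} [MeasurableSpace Ω] [NormedAddCommGroup H]
    [InnerProductSpace ℂ H] (E : OperatorSetFunction Ω H) : Prop where
  nonneg : ∀ X, 0 ≤ E X
  le_one : ∀ X, E X ≤ 1
  univ : E ⟨Set.univ, MeasurableSet.univ⟩ = 1
  iUnion : ∀ (X : ℕ → Set Ω) (hX : ∀ i, MeasurableSet (X i)),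
    Pairwise (fun i j => Disjoint (X i) (X j)) → ∀ f g : H,
      HasSum (fun i => ⟪f, E ⟨X i, hX i⟩ g⟫_ℂ) ⟪f, E ⟨⋃ i, X i, MeasurableSet.iUnion hX⟩ g⟫_ℂ

/-! ### Phase observables -/

/-- The Borel `σ`-algebra of the unit circle. -/
instance circleMeasurableSpace : MeasurableSpace Circle := borel Circle

instance circleBorelSpace : BorelSpace Circle := ⟨rfl⟩

/-- The Haar measure of the unit circle with total mass one. -/
def circleHaar : Measure Circle := Measure.haarMeasure ⊤

theorem circleHaar_univ : circleHaar Set.univ = 1 :=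
  Measure.haarMeasure_self (K₀ := (⊤ : TopologicalSpace.PositiveCompacts Circle))

variable {H : Type*} [NormedAddCommGroup H] [InnerProductSpace ℂ H] [CompleteSpace H]

/-- The orthonormal basis `n ↦ t ^ n • b n`. -/
def rotatedBasis (b : HilbertBasis ℕ ℂ H) (t : Circle) : HilbertBasis ℕ ℂ H :=
  HilbertBasis.mk (v := fun n => ((t : ℂ) ^ n) • b n)
    (by
      refine ⟨fun n => by
        rw [norm_smul, b.orthonormal.1 n, norm_pow, Circle.norm_coe, one_pow, one_mul], fun m n hmn => ?_⟩
      simp [inner_smul_left, inner_smul_right, b.orthonormal.2 hmn])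
    (by
      rw [← b.dense_span]
      refine Submodule.topologicalClosure_mono (Submodule.span_le.mpr ?_)
      rintro _ ⟨n, rfl⟩
      have hn : ((t : ℂ) ^ n) ≠ 0 := pow_ne_zero _ (Circle.coe_ne_zero t)
      have : b n = ((t : ℂ) ^ n)⁻¹ • (((t : ℂ) ^ n) • b n) := by
        rw [smul_smul, inv_mul_cancel₀ hn, one_smul]
      rw [this]
      exact Submodule.smul_mem _ _ (Submodule.subset_span ⟨n, rfl⟩))

/-- The number representation of the circle with respect to the orthonormal basis `b`: the unitary
operator `U(t)` with `U(t) (b n) = t ^ n • b n` (see `numberRep_apply`). -/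
def numberRep (b : HilbertBasis ℕ ℂ H) (t : Circle) : H ≃ₗᵢ[ℂ] H :=
  b.repr.trans (rotatedBasis b t).repr.symm

theorem numberRep_apply (b : HilbertBasis ℕ ℂ H) (t : Circle) (n : ℕ) :
    numberRep b t (b n) = ((t : ℂ) ^ n) • b n := by
  have h : (rotatedBasis b t) n = ((t : ℂ) ^ n) • b n :=
    congrFun (HilbertBasis.coe_mk _ _) n
  classical
  rw [← h]
  change (rotatedBasis b t).repr.symm (b.repr (b n)) = _
  rw [b.repr_self, HilbertBasis.repr_symm_single]

/-- The set of phase observables: observables `E` on the Borel sets of the circle such that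
`U(t) E(X) U(t)* = E(tX)`, with `U` the number representation. -/
def phaseObservables (b : HilbertBasis ℕ ℂ H) : Set (OperatorSetFunction Circle H) :=
  {E | IsObservable E ∧ ∀ (t : Circle) (X : {X : Set Circle // MeasurableSet X}),
    ((numberRep b t : H ≃L[ℂ] H) : H →L[ℂ] H) ∘L E X ∘L
        ContinuousLinearMap.adjoint ((numberRep b t : H ≃L[ℂ] H) : H →L[ℂ] H) =
      E ⟨t • (X : Set Circle), X.2.const_smul t⟩}

/-- `E` is determined by the matrix `c`:
`⟨b m, E(X) (b n)⟩ = c m n * ∫_X t ^ (m - n) dt`. -/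
def HasPhaseMatrix (b : HilbertBasis ℕ ℂ H) (E : OperatorSetFunction Circle H)
    (c : Matrix ℕ ℕ ℂ) : Prop :=
  ∀ (X : {X : Set Circle // MeasurableSet X}) (m n : ℕ),
    ⟪b m, E X (b n)⟫_ℂ =
      c m n * ∫ t in (X : Set Circle), (t : ℂ) ^ ((m : ℤ) - (n : ℤ)) ∂circleHaar

end

noncomputable section

/-! ### Perturbations of real phase matrices -/

/-! Realise `c` as the Gram matrix of unit vectors `η n` and replace the form `⟪x, y⟫` by `⟪x, (1 +
r A) y⟫`, where `A = i(|η p⟩⟨η q| - |η q⟩⟨η p|)` is self-adjoint. For `|r| ≤ 1/2` this stays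
positive (`inner_self_add_skew_nonneg`). A real `c` is symmetric, so `⟪η n, A η n⟫ = 0` and the unit
diagonal survives. The `(p, q)` entry moves by `i r (1 - c p q ^ 2)`, which is nonzero for some `p`,
`q` once the rank exceeds one (`exists_norm_ne_one_of_one_lt_phaseRank`). Hence `c` is the midpoint
of the distinct phase matrices with `r = ±1/2`.

Observables inherit this because the correspondence with matrices is affine and injective both ways.
Existence is a Naimark dilation (`exists_phaseObservable`): the functions `t ↦ t ^ (-n) • η n` are
orthonormal in `L²(𝕋; K)`, so `b n` maps to them isometrically, and restriction to `X` is compressed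
back to `H`. -/

/-- The matrix of the form `⟪x, y⟫ + r * I * (⟪x, η p⟫ * ⟪η q, y⟫ - ⟪x, η q⟫ * ⟪η p, y⟫)` at the
vectors `η n`, where `c` is the Gram matrix of `η`. -/
def skewPerturbation (c : Matrix ℕ ℕ ℂ) (p q : ℕ) (r : ℝ) : Matrix ℕ ℕ ℂ :=
  Matrix.of fun n m => c n m + r * Complex.I * (c n p * c q m - c n q * c p m)

theorem skewPerturbation_apply (c : Matrix ℕ ℕ ℂ) (p q : ℕ) (r : ℝ) (n m : ℕ) :
    skewPerturbation c p q r n m =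
      c n m + r * Complex.I * (c n p * c q m - c n q * c p m) := rfl

/-- Positive semidefiniteness is tested on finitely supported `x`; this reduces it to an inequality
for the single vector `∑ x i • η i`. -/
theorem sum_sum_gram_mul_eq_inner {K : Type*} [NormedAddCommGroup K] [InnerProductSpace ℂ K]
    (η : ℕ → K) (x : ℕ →₀ ℂ) (p q : ℕ) (r : ℝ) :
    (x.sum fun i xi => x.sum fun j xj => star xi *
      (⟪η i, η j⟫_ℂ + r * Complex.I * (⟪η i, η p⟫_ℂ * ⟪η q, η j⟫_ℂ - ⟪η i, η q⟫_ℂ * ⟪η p, η j⟫_ℂ))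
        * xj) =
    ⟪Finsupp.linearCombination ℂ η x, Finsupp.linearCombination ℂ η x⟫_ℂ +
      r * Complex.I *
        (⟪Finsupp.linearCombination ℂ η x, η p⟫_ℂ * ⟪η q, Finsupp.linearCombination ℂ η x⟫_ℂ -
          ⟪Finsupp.linearCombination ℂ η x, η q⟫_ℂ * ⟪η p, Finsupp.linearCombination ℂ η x⟫_ℂ) := by
  have hleft : ∀ y, ⟪Finsupp.linearCombination ℂ η x, y⟫_ℂ =
      ∑ i ∈ x.support, star (x i) * ⟪η i, y⟫_ℂ := fun y => by
    simp [Finsupp.linearCombination_apply, Finsupp.sum, mul_comm]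
  have hright : ∀ y, ⟪y, Finsupp.linearCombination ℂ η x⟫_ℂ =
      ∑ j ∈ x.support, x j * ⟪y, η j⟫_ℂ := fun y => by
    simp [Finsupp.linearCombination_apply, Finsupp.sum]
  rw [hleft, hleft, hleft, hright, hright, Finset.sum_mul_sum, Finset.sum_mul_sum]
  simp only [hright, Finset.mul_sum, ← Finset.sum_sub_distrib, ← Finset.sum_add_distrib,
    Finsupp.sum]
  refine Finset.sum_congr rfl fun i _ => Finset.sum_congr rfl fun j _ => ?_
  ring

/-- The bracket is `z - conj z` with `z = ⟪ξ, v⟫ * ⟪w, ξ⟫`, so the correction is `-2 r Im z`, and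
Cauchy–Schwarz gives `|z| ≤ ‖ξ‖ ^ 2`. This is where `1 / 2` comes from. -/
theorem inner_self_add_skew_nonneg {K : Type*} [NormedAddCommGroup K] [InnerProductSpace ℂ K]
    (ξ v w : K) (hv : ‖v‖ = 1) (hw : ‖w‖ = 1) {r : ℝ} (hr : |r| ≤ 1 / 2) :
    0 ≤ ⟪ξ, ξ⟫_ℂ + r * Complex.I * (⟪ξ, v⟫_ℂ * ⟪w, ξ⟫_ℂ - ⟪ξ, w⟫_ℂ * ⟪v, ξ⟫_ℂ) := by
  have hconj : ⟪ξ, w⟫_ℂ * ⟪v, ξ⟫_ℂ = (starRingEnd ℂ) (⟪ξ, v⟫_ℂ * ⟪w, ξ⟫_ℂ) := by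
    rw [map_mul, inner_conj_symm, inner_conj_symm, mul_comm]
  have hz : ‖⟪ξ, v⟫_ℂ * ⟪w, ξ⟫_ℂ‖ ≤ ‖ξ‖ ^ 2 := by
    rw [norm_mul, pow_two]
    refine mul_le_mul ?_ ?_ (norm_nonneg _) (norm_nonneg _)
    · simpa [hv] using norm_inner_le_norm (𝕜 := ℂ) ξ v
    · simpa [hw] using norm_inner_le_norm (𝕜 := ℂ) w ξ
  rw [hconj, inner_self_eq_norm_sq_to_K]
  generalize ⟪ξ, v⟫_ℂ * ⟪w, ξ⟫_ℂ = z at hz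
  have heq : ((‖ξ‖ : ℝ) : ℂ) ^ 2 + r * Complex.I * (z - (starRingEnd ℂ) z) =
      ((‖ξ‖ ^ 2 - 2 * r * z.im : ℝ) : ℂ) := by
    rw [Complex.sub_conj]
    push_cast
    linear_combination (2 * r * z.im : ℂ) * Complex.I_sq
  refine le_of_le_of_eq ?_ heq.symm
  rw [Complex.zero_le_real]
  have h1 : |2 * r * z.im| ≤ ‖ξ‖ ^ 2 := by
    rw [abs_mul, abs_mul, abs_two]
    have := (Complex.abs_im_le_norm z).trans hz
    nlinarith [abs_nonneg z.im, abs_nonneg r]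
  linarith [le_abs_self (2 * r * z.im)]

theorem skewPerturbation_mem_phaseMatrices {c : Matrix ℕ ℕ ℂ} (hc : c ∈ phaseMatrices)
    (hreal : ∀ m n, (c m n).im = 0) (p q : ℕ) {r : ℝ} (hr : |r| ≤ 1 / 2) :
    skewPerturbation c p q r ∈ phaseMatrices := by
  obtain ⟨K, _, _, _, η, hη⟩ := exists_isVectorSequence hc
  refine ⟨⟨?_, fun x => ?_⟩, fun n => ?_⟩
  · ext n m
    rw [Matrix.conjTranspose_apply, skewPerturbation_apply, skewPerturbation_apply]
    simp only [star_add, star_mul', star_sub, hc.1.1.apply]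
    simp only [Complex.star_def, Complex.conj_I, Complex.conj_ofReal]
    ring
  · simp only [skewPerturbation_apply, hη.gram]
    rw [sum_sum_gram_mul_eq_inner]
    exact inner_self_add_skew_nonneg _ _ _ (hη.norm_eq_one p) (hη.norm_eq_one q) hr
  -- Hermitian and real means symmetric, so the two products in the perturbation cancel on the
  -- diagonal.
  · have hsymm : ∀ m, c n m = c m n := fun m => by
      rw [← hc.1.1.apply n m, Complex.star_def, Complex.conj_eq_iff_im.mpr (hreal m n)]
    rw [skewPerturbation_apply, hc.2, hsymm p, hsymm q]
    ring

/-- Otherwise equality holds in Cauchy–Schwarz throughout, and every `η n` lies on the closed line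
through `η 0`. -/
theorem exists_norm_ne_one_of_one_lt_phaseRank {c : Matrix ℕ ℕ ℂ} (hc : c ∈ phaseMatrices)
    (hrank : 1 < phaseRank c) : ∃ p q, ‖c p q‖ ≠ 1 := by
  obtain ⟨K, _, _, _, η, hη⟩ := exists_isVectorSequence hc
  by_contra! h
  refine hrank.not_ge ?_
  rw [phaseRank_eq hη]
  have hspan : Submodule.span ℂ (Set.range η) ≤ Submodule.span ℂ {η 0} := by
    refine Submodule.span_le.mpr ?_
    rintro _ ⟨n, rfl⟩
    have hne : ∀ k, η k ≠ 0 := fun k => norm_ne_zero_iff.mp (by simp [hη.norm_eq_one k])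
    have := (norm_inner_eq_norm_tfae ℂ (η 0) (η n)).out 0 3
    have h0 := this.mp (by rw [← hη.gram, h, hη.norm_eq_one, hη.norm_eq_one, one_mul])
    exact h0.resolve_left (hne 0)
  have htop : Submodule.span ℂ {η 0} = ⊤ := by
    rw [eq_top_iff, ← hη.total]
    exact Submodule.topologicalClosure_minimal _ hspan
      (Submodule.closed_of_finiteDimensional _)
  have hle : Module.rank ℂ K ≤ 1 := by
    rw [← rank_top ℂ K, ← htop]
    exact (rank_span_le _).trans (by simp)
  simpa using Cardinal.toENat.monotone' hle

theorem skewPerturbation_ne {c : Matrix ℕ ℕ ℂ} (hc : c ∈ phaseMatrices)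
    {p q : ℕ} (hpq : ‖c p q‖ ≠ 1) {r : ℝ} (hr : r ≠ 0) :
    skewPerturbation c p q r p q ≠ c p q := by
  rw [skewPerturbation_apply, hc.2, hc.2, ne_eq, add_eq_left, mul_eq_zero, not_or]
  refine ⟨by simp [hr], fun h => hpq ?_⟩
  have h' : ‖c p q‖ ^ 2 = 1 := by
    rw [← norm_pow, pow_two, ← sub_eq_zero.mp h]
    simp
  exact (pow_eq_one_iff_of_nonneg (norm_nonneg _) two_ne_zero).mp h'

theorem half_smul_skewPerturbation_add (c : Matrix ℕ ℕ ℂ) (p q : ℕ) (r : ℝ) :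
    (1 / 2 : ℝ) • skewPerturbation c p q r + (1 / 2 : ℝ) • skewPerturbation c p q (-r) = c := by
  ext n m
  simp only [Matrix.add_apply, Matrix.smul_apply, skewPerturbation_apply, Complex.real_smul]
  push_cast
  ring

/-! ### Characters of the circle -/

instance circleHaar_isHaarMeasure : circleHaar.IsHaarMeasure :=
  inferInstanceAs (Measure.haarMeasure ⊤).IsHaarMeasure

instance circleHaar_isProbabilityMeasure : IsProbabilityMeasure circleHaar :=
  ⟨circleHaar_univ⟩

theorem continuous_circle_zpow (k : ℤ) : Continuous fun t : Circle => (t : ℂ) ^ k :=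
  Continuous.zpow₀ (by fun_prop) k fun t => Or.inl (Circle.coe_ne_zero t)

theorem integrable_circle_zpow (k : ℤ) : Integrable (fun t : Circle => (t : ℂ) ^ k) circleHaar :=
  Integrable.of_bound (continuous_circle_zpow k).aestronglyMeasurable 1
    (Filter.Eventually.of_forall fun t => by
      rw [norm_zpow, Circle.norm_coe, _root_.one_zpow])

theorem setIntegral_smul_circle_zpow (s : Circle) (X : Set Circle) (k : ℤ) :
    ∫ t in s • X, (t : ℂ) ^ k ∂circleHaar = (s : ℂ) ^ k * ∫ t in X, (t : ℂ) ^ k ∂circleHaar := by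
  have hmp := measurePreserving_mul_left circleHaar s
  have hX : s • X = (fun t => s * t) '' X := rfl
  rw [hX, hmp.setIntegral_image_emb (MeasurableEquiv.mulLeft s).measurableEmbedding,
    ← integral_const_mul]
  simp only [Circle.coe_mul, mul_zpow]

theorem integral_circle_zpow (k : ℤ) :
    ∫ t : Circle, (t : ℂ) ^ k ∂circleHaar = if k = 0 then 1 else 0 := by
  split_ifs with hk
  · simp [hk]
  -- Translating by a point whose `k`-th power is `-1` shows that the integral equals its own
  -- negative.
  · have hs : ((Circle.exp (Real.pi / k) : Circle) : ℂ) ^ k = -1 := by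
      rw [Circle.coe_exp, ← Complex.exp_int_mul]
      have : (k : ℂ) ≠ 0 := by exact_mod_cast hk
      rw [← Complex.exp_pi_mul_I]
      congr 1
      push_cast
      field_simp
    have h := setIntegral_smul_circle_zpow (Circle.exp (Real.pi / k)) Set.univ k
    rw [Set.smul_set_univ, setIntegral_univ, hs] at h
    linear_combination h / 2

/-- A character vanishes nowhere, so its integrals over measurable sets cannot all be zero. This
lets the matrix be recovered from the observable. -/
theorem exists_setIntegral_circle_zpow_ne_zero (k : ℤ) :
    ∃ X : {X : Set Circle // MeasurableSet X},
      ∫ t in (X : Set Circle), (t : ℂ) ^ k ∂circleHaar ≠ 0 := by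
  by_contra! h
  have h0 := (integrable_circle_zpow k).ae_eq_zero_of_forall_setIntegral_eq_zero
    fun s hs _ => h ⟨s, hs⟩
  obtain ⟨t, ht⟩ := h0.exists
  exact zpow_ne_zero k (Circle.coe_ne_zero t) ht

/-! ### Uniqueness of the operator set function of a phase matrix -/

section

variable {H : Type*} [NormedAddCommGroup H] [InnerProductSpace ℂ H]

theorem HilbertBasis.continuousLinearMap_ext {ι : Type*} (b : HilbertBasis ι ℂ H)
    {A B : H →L[ℂ] H} (h : ∀ m n, ⟪b m, A (b n)⟫_ℂ = ⟪b m, B (b n)⟫_ℂ) : A = B := by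
  have hd : Dense (Submodule.span ℂ (Set.range b) : Set H) :=
    Submodule.dense_iff_topologicalClosure_eq_top.mpr b.dense_span
  refine ContinuousLinearMap.ext_on hd ?_
  rintro _ ⟨n, rfl⟩
  refine b.repr.injective (lp.ext (funext fun m => ?_))
  rw [b.repr_apply_apply, b.repr_apply_apply, h]

theorem HilbertBasis.exists_linearIsometry_of_orthonormal {ι K : Type*} [NormedAddCommGroup K]
    [InnerProductSpace ℂ K] [CompleteSpace K] (b : HilbertBasis ι ℂ H) {v : ι → K}
    (hv : Orthonormal ℂ v) : ∃ V : H →ₗᵢ[ℂ] K, ∀ i, V (b i) = v i := by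
  classical
  refine ⟨hv.orthogonalFamily.linearIsometry.comp b.repr.toLinearIsometry, fun i => ?_⟩
  have h : hv.orthogonalFamily.linearIsometry (b.repr (b i)) = v i := by
    rw [b.repr_self, OrthogonalFamily.linearIsometry_apply_single]
    simp
  exact h

theorem HasPhaseMatrix.unique {b : HilbertBasis ℕ ℂ H} {c : Matrix ℕ ℕ ℂ}
    {E F : OperatorSetFunction Circle H} (hE : HasPhaseMatrix b E c)
    (hF : HasPhaseMatrix b F c) : E = F :=
  funext fun X => b.continuousLinearMap_ext fun m n => by rw [hE, hF]

theorem HasPhaseMatrix.matrix_unique {b : HilbertBasis ℕ ℂ H} {c d : Matrix ℕ ℕ ℂ}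
    {E : OperatorSetFunction Circle H} (hc : HasPhaseMatrix b E c)
    (hd : HasPhaseMatrix b E d) : c = d := by
  ext m n
  obtain ⟨X, hX⟩ := exists_setIntegral_circle_zpow_ne_zero ((m : ℤ) - n)
  exact mul_right_cancel₀ hX ((hc X m n).symm.trans (hd X m n))

theorem HasPhaseMatrix.combination {b : HilbertBasis ℕ ℂ H} {c d : Matrix ℕ ℕ ℂ}
    {E F : OperatorSetFunction Circle H} (hE : HasPhaseMatrix b E c)
    (hF : HasPhaseMatrix b F d) (α β : ℝ) :
    HasPhaseMatrix b (α • E + β • F) (α • c + β • d) := fun X m n => by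
  have h : (α • E + β • F) X (b n) = (α : ℂ) • E X (b n) + (β : ℂ) • F X (b n) := by
    simp
  rw [h, inner_add_right, inner_smul_right, inner_smul_right, hE, hF]
  simp only [Matrix.add_apply, Matrix.smul_apply, Complex.real_smul]
  ring

end

/-! ### Existence of the phase observable of a phase matrix -/

section

variable {Ω H K : Type*} [MeasurableSpace Ω] {μ : Measure Ω} [NormedAddCommGroup H]
  [InnerProductSpace ℂ H] [CompleteSpace H] [NormedAddCommGroup K] [InnerProductSpace ℂ K]
  [CompleteSpace K]

/-- The compression along `V` of the canonical spectral measure of `L²(μ; K)`. -/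
def compressedObservable (V : H →ₗᵢ[ℂ] Lp K 2 μ) : OperatorSetFunction Ω H := fun X =>
  ContinuousLinearMap.adjoint (LpToLpRestrictCLM Ω K ℂ μ 2 X ∘L V.toContinuousLinearMap) ∘L
    (LpToLpRestrictCLM Ω K ℂ μ 2 X ∘L V.toContinuousLinearMap)

theorem inner_compressedObservable (V : H →ₗᵢ[ℂ] Lp K 2 μ) (X : {X : Set Ω // MeasurableSet X})
    (f g : H) :
    ⟪f, compressedObservable V X g⟫_ℂ = ∫ t in (X : Set Ω), ⟪V f t, V g t⟫_ℂ ∂μ := by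
  rw [compressedObservable, ContinuousLinearMap.comp_apply,
    ContinuousLinearMap.adjoint_inner_right, L2.inner_def]
  refine integral_congr_ae ?_
  filter_upwards [LpToLpRestrictCLM_coeFn ℂ (X : Set Ω) (V f),
    LpToLpRestrictCLM_coeFn ℂ (X : Set Ω) (V g)] with t hf hg
  exact congrArg₂ _ hf hg

theorem compressedObservable_univ (V : H →ₗᵢ[ℂ] Lp K 2 μ) :
    compressedObservable V ⟨Set.univ, MeasurableSet.univ⟩ = 1 := by
  ext g
  refine ext_inner_left ℂ fun f => ?_
  rw [inner_compressedObservable, setIntegral_univ, ← L2.inner_def, V.inner_map_map]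
  rfl

theorem isObservable_compressedObservable (V : H →ₗᵢ[ℂ] Lp K 2 μ) :
    IsObservable (compressedObservable V) where
  nonneg X := by
    rw [ContinuousLinearMap.nonneg_iff_isPositive]
    exact ContinuousLinearMap.isPositive_adjoint_comp_self _
  le_one X := by
    rw [ContinuousLinearMap.le_def]
    -- The complementary effect has the same shape `A* A`, so the upper bound reduces to positivity.
    have h : 1 - compressedObservable V X = compressedObservable V ⟨Xᶜ, X.2.compl⟩ := by
      ext g
      refine ext_inner_left ℂ fun f => ?_
      rw [← compressedObservable_univ V, _root_.sub_apply, inner_sub_right,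
        inner_compressedObservable, inner_compressedObservable, inner_compressedObservable,
        setIntegral_univ, sub_eq_iff_eq_add', integral_add_compl X.2 (L2.integrable_inner _ _)]
    rw [h]
    exact ContinuousLinearMap.isPositive_adjoint_comp_self _
  univ := compressedObservable_univ V
  iUnion X hX hdisj f g := by
    simp only [inner_compressedObservable]
    exact hasSum_integral_iUnion hX hdisj (L2.integrable_inner _ _).integrableOn

end

section

variable {K : Type*} [NormedAddCommGroup K] [InnerProductSpace ℂ K]

/-- The element `t ↦ t ^ (-n) • η n` of `L²(𝕋; K)`. -/
def rotatingVector (η : ℕ → K) (n : ℕ) : Lp K 2 circleHaar :=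
  ContinuousMap.toLp 2 circleHaar ℂ
    ⟨fun t : Circle => (t : ℂ) ^ (-(n : ℤ)) • η n,
      (continuous_circle_zpow _).smul continuous_const⟩

/-- The inner product conjugates its first argument, which turns `t ^ (-m)` into `t ^ m`; hence the
negative exponents in `rotatingVector`. -/
theorem inner_rotatingVector_ae (η : ℕ → K) (m n : ℕ) :
    (fun t => ⟪rotatingVector η m t, rotatingVector η n t⟫_ℂ) =ᵐ[circleHaar]
      fun t => ⟪η m, η n⟫_ℂ * (t : ℂ) ^ ((m : ℤ) - n) := by
  filter_upwards [ContinuousMap.coeFn_toLp (p := 2) (𝕜 := ℂ) circleHaar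
      (⟨fun t : Circle => (t : ℂ) ^ (-(m : ℤ)) • η m,
        (continuous_circle_zpow _).smul continuous_const⟩ : C(Circle, K)),
    ContinuousMap.coeFn_toLp (p := 2) (𝕜 := ℂ) circleHaar
      (⟨fun t : Circle => (t : ℂ) ^ (-(n : ℤ)) • η n,
        (continuous_circle_zpow _).smul continuous_const⟩ : C(Circle, K))] with t hm hn
  rw [rotatingVector, rotatingVector, hm, hn, ContinuousMap.coe_mk, ContinuousMap.coe_mk,
    inner_smul_left, inner_smul_right, map_zpow₀, ← Circle.coe_inv_eq_conj, Circle.coe_inv,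
    _root_.inv_zpow', neg_neg, sub_eq_add_neg, zpow_add₀ (Circle.coe_ne_zero t)]
  ring

theorem orthonormal_rotatingVector {η : ℕ → K} (hη : ∀ n, ‖η n‖ = 1) :
    Orthonormal ℂ (rotatingVector η) := by
  rw [orthonormal_iff_ite]
  intro m n
  rw [L2.inner_def, integral_congr_ae (inner_rotatingVector_ae η m n), integral_const_mul,
    integral_circle_zpow]
  split_ifs with h1 h2 h2
  · subst h2
    simp [inner_self_eq_norm_sq_to_K, hη]
  · omega
  · omega
  · simp

end

section

variable {H : Type*} [NormedAddCommGroup H] [InnerProductSpace ℂ H] [CompleteSpace H]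

theorem adjoint_numberRep_apply (b : HilbertBasis ℕ ℂ H) (t : Circle) (n : ℕ) :
    ContinuousLinearMap.adjoint ((numberRep b t : H ≃L[ℂ] H) : H →L[ℂ] H) (b n) =
      ((t : ℂ) ^ (-(n : ℤ))) • b n := by
  have h := numberRep_apply b t n
  have h2 : ContinuousLinearMap.adjoint ((numberRep b t : H ≃L[ℂ] H) : H →L[ℂ] H)
      (numberRep b t (b n)) = b n :=
    ext_inner_left ℂ fun f => by
      rw [ContinuousLinearMap.adjoint_inner_right]
      exact (numberRep b t).inner_map_map f (b n)
  rw [h, map_smul] at h2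
  rw [_root_.zpow_neg, zpow_natCast]
  nth_rw 2 [← h2]
  rw [smul_smul, inv_mul_cancel₀ (pow_ne_zero _ (Circle.coe_ne_zero t)), one_smul]

/-- Covariance needs only the matrix elements: conjugation by `U(t)` and, by invariance of Haar
measure, translation of `X` both produce the factor `t ^ (m - n)`. -/
theorem HasPhaseMatrix.covariant {b : HilbertBasis ℕ ℂ H} {c : Matrix ℕ ℕ ℂ}
    {E : OperatorSetFunction Circle H} (hE : HasPhaseMatrix b E c) (t : Circle)
    (X : {X : Set Circle // MeasurableSet X}) :
    ((numberRep b t : H ≃L[ℂ] H) : H →L[ℂ] H) ∘L E X ∘L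
        ContinuousLinearMap.adjoint ((numberRep b t : H ≃L[ℂ] H) : H →L[ℂ] H) =
      E ⟨t • (X : Set Circle), X.2.const_smul t⟩ := by
  refine b.continuousLinearMap_ext fun m n => ?_
  rw [ContinuousLinearMap.comp_apply, ContinuousLinearMap.comp_apply,
    ← ContinuousLinearMap.adjoint_inner_left, adjoint_numberRep_apply, adjoint_numberRep_apply,
    map_smul, inner_smul_left, inner_smul_right, hE, hE, setIntegral_smul_circle_zpow,
    map_zpow₀, ← Circle.coe_inv_eq_conj, Circle.coe_inv, _root_.inv_zpow', neg_neg, sub_eq_add_neg,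
    zpow_add₀ (Circle.coe_ne_zero t)]
  ring

theorem exists_phaseObservable (b : HilbertBasis ℕ ℂ H) {c : Matrix ℕ ℕ ℂ}
    (hc : c ∈ phaseMatrices) :
    ∃ E : OperatorSetFunction Circle H, E ∈ phaseObservables b ∧ HasPhaseMatrix b E c := by
  obtain ⟨K, _, _, _, η, hη⟩ := exists_isVectorSequence hc
  obtain ⟨V, hV⟩ :=
    b.exists_linearIsometry_of_orthonormal (orthonormal_rotatingVector hη.norm_eq_one)
  have hE : HasPhaseMatrix b (compressedObservable V) c := fun X m n => by
    rw [inner_compressedObservable, hV, hV,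
      integral_congr_ae (ae_restrict_of_ae (inner_rotatingVector_ae η m n)),
      integral_const_mul, hη.gram]
  exact ⟨_, ⟨isObservable_compressedObservable V, hE.covariant⟩, hE⟩

end

theorem mainTheorem9 {H : Type*} [NormedAddCommGroup H] [InnerProductSpace ℂ H] [CompleteSpace H]
    (b : HilbertBasis ℕ ℂ H) (c : Matrix ℕ ℕ ℂ) (hc : c ∈ phaseMatrices)
    (hrank : 1 < phaseRank c) (hreal : ∀ m n, (c m n).im = 0) :
    c ∉ Set.extremePoints ℝ phaseMatrices ∧
      (∃! E : OperatorSetFunction Circle H, E ∈ phaseObservables b ∧ HasPhaseMatrix b E c) ∧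
      ∀ E ∈ phaseObservables b, HasPhaseMatrix b E c →
        E ∉ Set.extremePoints ℝ (phaseObservables b) := by
  obtain ⟨p, q, hpq⟩ := exists_norm_ne_one_of_one_lt_phaseRank hc hrank
  have hplus := skewPerturbation_mem_phaseMatrices hc hreal p q (r := 1 / 2) (by simp [abs_of_pos])
  have hminus :=
    skewPerturbation_mem_phaseMatrices hc hreal p q (r := -(1 / 2)) (by simp [abs_of_pos])
  have hmid := half_smul_skewPerturbation_add c p q (1 / 2)
  have hne : skewPerturbation c p q (1 / 2) ≠ c := fun h =>
    skewPerturbation_ne hc hpq (r := 1 / 2) (by norm_num) (congrFun (congrFun h p) q)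
  refine ⟨fun hext => ?_, ?_, fun E _ hE hext => ?_⟩
  · exact hne (hext.2 hplus hminus
      ⟨1 / 2, 1 / 2, by norm_num, by norm_num, by norm_num, hmid⟩)
  · obtain ⟨E, hE⟩ := exists_phaseObservable b hc
    exact ⟨E, hE, fun F hF => hF.2.unique hE.2⟩
  · obtain ⟨F, hF, hFc⟩ := exists_phaseObservable b hplus
    obtain ⟨G, hG, hGc⟩ := exists_phaseObservable b hminus
    have hsum := hFc.combination hGc (1 / 2) (1 / 2)
    rw [hmid] at hsum
    have hFE : F = E := hext.2 hF hG
      -- The midpoint of `F` and `G` has matrix `c`, so it is `E` by uniqueness.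
      ⟨1 / 2, 1 / 2, by norm_num, by norm_num, by norm_num, hsum.unique hE⟩
    exact hne (hFc.matrix_unique (hFE ▸ hE))

end
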